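/- Let $\mathcal H=\mathbb C^d$ and let $\mathfrak D(\mathcal H)$ be the set of density matrices on $\mathcal H$ (positive semidefinite, trace one). A \emph{CPTP projection onto} a linear subspace $\mathcal A\subseteq\mathcal B(\mathcal H)$ is a completely positive, trace-preserving linear map $\mathcal E$ on $\mathcal B(\mathcal H)$ with $\mathcal E^2=\mathcal E$ and image (equivalently, fixed-point set) $\mathcal A$. Let $\mathcal E_1,\dots,\mathcal E_r$ be CPTP projections onto $\mathcal A_1,\dots,\mathcal A_r$, and assume that $\hat{\mathcal A}=\bigcap_{i=1}^r\mathcal A_i$ contains a density matrix $\rho$ of full rank $d$. Let $j(0),j(1),j(2),\dots$ be independent random variables with values in $\{1,\dots,r\}$ (not necessarily identically distributed), and assume that there is $\epsilon>0$ such that $\mathbb P[j(t)=i]>\epsilon$ for all $t\ge 0$ and all $i$. For $\tau\in\mathfrak D(\mathcal H)$ put $$\tau(t)=\mathcal E_{j(t)}\circ\cdots\circ\mathcal E_{j(1)}(\tau),\qquad \tau(0)=\tau .$$ Then there is exactly one CPTP projection $\mathcal E_{\hat{\mathcal A}}$ onto $\hat{\mathcal A}$, and for every $\tau\in\mathfrak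 D(\mathcal H)$ the process $\tau(t)$ converges to $\tau^*=\mathcal E_{\hat{\mathcal A}}(\tau)$ 1. in probability: for all $\delta,\varepsilon>0$ there is $T$ such that $\mathbb P\big[\mathrm{Tr}\big((\tau(t)-\tau^*)^2\big)>\varepsilon\big]<\delta$ for all $t\ge T$; and 2. in expectation: $\mathbb E[\tau(t)]\to\tau^*$ as $t\to\infty$. -/

import Mathlib

open Filter Topology MeasureTheory ProbabilityTheory
open scoped Matrix.Norms.L2Operator MatrixOrder ComplexOrder CStarAlgebra

/-- Operators on the Hilbert space `ℂ^d`, as complex `d × d` matrices. With the operator norm and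
the Loewner order they form a C⋆-algebra. -/
abbrev Op (d : ℕ) : Type := Matrix (Fin d) (Fin d) ℂ

/-- Density matrices: positive semidefinite operators of trace one. -/
def IsState {d : ℕ} (ρ : Op d) : Prop :=
  ρ.PosSemidef ∧ ρ.trace = 1

/-- Completely positive trace-preserving linear maps. -/
def IsCPTP {d : ℕ} (E : Op d →ₗ[ℂ] Op d) : Prop :=
  (∃ Φ : Op d →CP Op d, Φ.toLinearMap = E) ∧ ∀ X : Op d, (E X).trace = X.trace

/-- `E` is a CPTP projection onto `A`: an idempotent CPTP map whose image is `A`. (By idempotence,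
`A` is also the fixed-point set of `E`.) -/
def IsCPTPProjectionOnto {d : ℕ} (E : Op d →ₗ[ℂ] Op d) (A : Submodule ℂ (Op d)) : Prop :=
  IsCPTP E ∧ (∀ X : Op d, E (E X) = E X) ∧ LinearMap.range E = A

/-- The state `E_{j(t)} ∘ ⋯ ∘ E_{j(1)} (τ)` reached at time `t` from `τ` when the map with index
`j s` is applied at step `s`. -/
def trajectory {d r : ℕ} (E : Fin r → Op d →ₗ[ℂ] Op d) (j : ℕ → Fin r) (τ : Op d) : ℕ → Op d
  | 0 => τ
  | t + 1 => E (j (t + 1)) (trajectory E j τ t)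

/-- Convergence in probability of an operator-valued process, measured by `Tr ((X t - Y)²)`
(which is the squared Hilbert-Schmidt distance, as the operators are self-adjoint). -/
def ConvergesInProbability {d : ℕ} {Ω : Type*} [MeasurableSpace Ω] (P : Measure Ω)
    (X : ℕ → Ω → Op d) (Y : Op d) : Prop :=
  ∀ δ > (0 : ℝ), ∀ ε > (0 : ℝ), ∃ T : ℕ, ∀ t ≥ T,
    P.real {ω | ((X t ω - Y) ^ 2).trace.re > ε} < δ

/-- Convergence in expectation of an operator-valued process. -/
def ConvergesInExpectation {d : ℕ} {Ω : Type*} [MeasurableSpace Ω] (P : Measure Ω)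
    (X : ℕ → Ω → Op d) (Y : Op d) : Prop :=
  (∀ t, Integrable (X t) P) ∧ Tendsto (fun t => ∫ ω, X t ω ∂P) atTop (𝓝 Y)

/-! The weighted inner product `Tr (X⋆ ρ⁻¹ Y)` turns the problem into one about orthogonal
projections. Complete positivity gives the operator Schwarz inequality `Φ(X)⋆ ρ⁻¹ Φ(X) ≤ Φ(X⋆ ρ⁻¹
X)` when `Φ ρ = ρ`; taking traces, every CPTP map fixing `ρ` is a contraction. A contractive
idempotent is orthogonal, so a CPTP projection onto a subspace containing `ρ` is determined by that
subspace, which is uniqueness.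

For existence, powers of the average of the `E i` converge to the orthogonal projection onto the
intersection, and being CPTP survives averages, products and limits.

For the random process, the error stays orthogonal to the intersection. By compactness of the unit
sphere there, the squared distances to the subspaces sum to at least `κ` times the squared norm, so
a step that picks each subspace with probability above `ε`, independently of the past, shrinks the
mean-square error by the factor `1 - ε * κ`. Both modes of convergence follow from mean-square
decay. -/

/-! ### Operator Schwarz inequality for completely positive maps. -/

section CompletelyPositive

variable {B : Type*} [CStarAlgebra B] [PartialOrder B] [StarOrderedRing B]

theorem CStarMatrix.diag_nonneg {k : ℕ} {M : CStarMatrix (Fin k) (Fin k) B} (hM : 0 ≤ M)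
    (i : Fin k) : 0 ≤ M i i := by
  rw [StarOrderedRing.nonneg_iff] at hM
  induction hM using AddSubmonoid.closure_induction with
  | mem M hM =>
    obtain ⟨S, rfl⟩ := hM
    change 0 ≤ (star S * S) i i
    rw [CStarMatrix.mul_apply]
    refine Finset.sum_nonneg fun l _ => ?_
    rw [CStarMatrix.star_apply]
    exact star_mul_self_nonneg _
  | zero => exact le_rfl
  | add M N _ _ hM hN => exact add_nonneg hM hN

/-- **Kadison–Schwarz inequality**, weighted by the inverse `R` of a positive fixed point `ρ`. -/
theorem CompletelyPositiveMap.star_mul_inverse_mul_le (Φ : B →CP B) {ρ R : B} (hρ : 0 ≤ ρ)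
    (h1 : ρ * R = 1) (h2 : R * ρ = 1) (hfix : Φ ρ = ρ) (X : B) :
    star (Φ X) * R * Φ X ≤ Φ (star X * R * X) := by
  have hρs : star ρ = ρ := (IsSelfAdjoint.of_nonneg hρ).star_eq
  have hRs : star R = R := by
    have : star R * ρ = 1 := by simpa [hρs] using congrArg star h1
    calc star R = star R * (ρ * R) := by rw [h1, mul_one]
      _ = R := by rw [← mul_assoc, this, one_mul]
  have hR : 0 ≤ R := by
    have := star_left_conjugate_nonneg hρ R
    rwa [hRs, h2, one_mul] at this
  -- This block matrix is positive with zero Schur complement. Applying `Φ` entrywise keeps it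
  -- positive, and the Schur complement of the image is the claimed inequality.
  let N : CStarMatrix (Fin 2) (Fin 2) B :=
    CStarMatrix.ofMatrix !![ρ, X; star X, star X * R * X]
  have hN : 0 ≤ N := by
    obtain ⟨s, hs⟩ := CStarAlgebra.nonneg_iff_eq_star_mul_self.mp hR
    let C : CStarMatrix (Fin 2) (Fin 2) B := CStarMatrix.ofMatrix !![s * ρ, s * X; 0, 0]
    have e1 : ∀ x y : B, star x * star s * (s * y) = star x * R * y := fun x y => by
      rw [hs]; simp only [mul_assoc]
    have : N = star C * C := by
      ext1 i j
      rw [CStarMatrix.mul_apply]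
      have e2 := e1 ρ ρ
      have e3 := e1 ρ X
      rw [hρs] at e2 e3
      fin_cases i <;> fin_cases j <;>
        simp [N, C, Fin.sum_univ_two, CStarMatrix.star_apply, hρs, e1, e2, e3, h1]
      rw [mul_assoc, h2, mul_one]
    rw [this]; exact star_mul_self_nonneg C
  have hstar : Φ (star X) = star (Φ X) := map_star Φ X
  have hEN := Φ.map_cstarMatrix_nonneg' 2 N hN
  -- The second column eliminates the off-diagonal block, so conjugation by `D` puts the Schur
  -- complement in the lower right corner.
  let D : CStarMatrix (Fin 2) (Fin 2) B := CStarMatrix.ofMatrix !![0, -(R * Φ X); 0, 1]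
  have h := CStarMatrix.diag_nonneg (star_left_conjugate_nonneg hEN D) 1
  have key : (star D * N.map Φ.toLinearMap * D) 1 1
      = Φ (star X * R * X) - star (Φ X) * R * Φ X := by
    have c : ∀ Y, Φ.toLinearMap Y = Φ Y := fun _ => rfl
    simp [CStarMatrix.mul_apply, Fin.sum_univ_two, CStarMatrix.star_apply, N, D, c, hfix, hstar,
      hRs, mul_assoc]
    have e4 : ρ * (R * Φ X) = Φ X := by rw [← mul_assoc, h1, one_mul]
    simp [add_mul, mul_assoc, e4]
    abel
  rw [key] at h
  exact sub_nonneg.mp h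

end CompletelyPositive

/-! ### Orthogonal projections in a finite-dimensional Hilbert space. -/

section Projections

variable {V : Type*} [NormedAddCommGroup V] [InnerProductSpace ℂ V] [FiniteDimensional ℂ V]

/-- A contractive idempotent is the orthogonal projection onto its range. -/
theorem LinearMap.eq_starProjection_range_of_idempotent_of_contractive (T : V →ₗ[ℂ] V)
    (hT : ∀ v, T (T v) = T v) (hc : ∀ v, ‖T v‖ ≤ ‖v‖) (v : V) :
    T v = (LinearMap.range T).starProjection v := by
  refine (Submodule.eq_starProjection_of_mem_orthogonal (LinearMap.mem_range_self T v) ?_).symm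
  have key : LinearMap.ker T ≤ (LinearMap.range T)ᗮ := by
    intro w hw
    rw [LinearMap.mem_ker] at hw
    set K := LinearMap.ker T
    rw [Submodule.mem_orthogonal']
    rintro _ ⟨u, rfl⟩
    -- For `z` in the kernel, `‖T u‖ = ‖T (T u - z)‖ ≤ ‖T u - z‖`: the point of the kernel nearest
    -- to `T u` is `0`.
    have hu : ∀ z ∈ K, inner ℂ (T u - 0) z = 0 := by
      rw [← K.norm_eq_iInf_iff_inner_eq_zero (u := T u) (v := 0) K.zero_mem]
      refine le_antisymm (le_ciInf fun z => ?_) (ciInf_le ⟨0, ?_⟩ (0 : K))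
      · have hz : T z = 0 := z.2
        have := hc (T u - z)
        rwa [map_sub, hz, hT] at this
      · rintro _ ⟨z, rfl⟩; exact norm_nonneg _
    have := hu w hw
    rw [sub_zero] at this
    exact inner_eq_zero_symm.mp this
  apply key
  rw [LinearMap.mem_ker, map_sub, hT, sub_self]

theorem Submodule.norm_sq_starProjection (K : Submodule ℂ V) (v : V) :
    ‖K.starProjection v‖ ^ 2 = ‖v‖ ^ 2 - ‖v - K.starProjection v‖ ^ 2 := by
  have := K.norm_sq_eq_add_norm_sq_starProjection v
  rw [Submodule.starProjection_orthogonal_val] at this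
  linarith

/-- The part of `v` removed by the projection lies in `Lᗮ ≤ Kᗮ`. This keeps the error orthogonal to
the intersection at every step. -/
theorem Submodule.starProjection_mem_orthogonal_of_le {K L : Submodule ℂ V} (h : K ≤ L) {v : V}
    (hv : v ∈ Kᗮ) : L.starProjection v ∈ Kᗮ := by
  have h1 : v - L.starProjection v ∈ Kᗮ :=
    Submodule.orthogonal_le h (L.sub_starProjection_mem_orthogonal v)
  simpa using Kᗮ.sub_mem hv h1

/-- On the complement of the intersection, the total squared distance to finitely many subspaces
is bounded below. -/
theorem exists_sum_dist_sq_ge {ι : Type*} [Fintype ι] (K : ι → Submodule ℂ V) :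
    ∃ κ : ℝ, 0 < κ ∧ κ ≤ 1 ∧ ∀ v ∈ (⨅ i, K i)ᗮ,
      κ * ‖v‖ ^ 2 ≤ ∑ i, ‖v - (K i).starProjection v‖ ^ 2 := by
  set S : Set V := Metric.sphere 0 1 ∩ ((⨅ i, K i)ᗮ : Submodule ℂ V)
  have hS : IsCompact S :=
    have : ProperSpace V := FiniteDimensional.proper ℂ V
    (isCompact_sphere 0 1).inter_right (Submodule.closed_of_finiteDimensional _)
  let f : V → ℝ := fun v => ∑ i, ‖v - (K i).starProjection v‖ ^ 2
  have hf : Continuous f := by fun_prop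
  have hpos : ∀ v ∈ S, 0 < f v := by
    rintro v ⟨hv1, hv2⟩
    refine lt_of_le_of_ne (Finset.sum_nonneg fun i _ => sq_nonneg _) fun h0 => ?_
    have h1 := (Finset.sum_eq_zero_iff_of_nonneg (fun i _ => sq_nonneg _)).mp h0.symm
    have hv : v ∈ ⨅ i, K i := by
      rw [Submodule.mem_iInf]
      intro i
      have := h1 i (Finset.mem_univ i)
      rw [← Submodule.starProjection_eq_self_iff]
      have h2 : v - (K i).starProjection v = 0 := by simpa using this
      exact (sub_eq_zero.mp h2).symm
    have : v = 0 := by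
      have := Submodule.inner_right_of_mem_orthogonal hv hv2
      exact inner_self_eq_zero.mp this
    simp [this] at hv1
  obtain ⟨κ, hκ, hle⟩ : ∃ κ : ℝ, 0 < κ ∧ ∀ v ∈ S, κ ≤ f v := by
    rcases S.eq_empty_or_nonempty with h | h
    · exact ⟨1, one_pos, by simp [h]⟩
    · obtain ⟨v, hv, hmin⟩ := hS.exists_isMinOn h hf.continuousOn
      exact ⟨f v, hpos v hv, fun w hw => hmin hw⟩
  -- The cap at `1` makes the later contraction factors `1 - κ / r` and `1 - ε * κ` nonnegative.
  refine ⟨min κ 1, lt_min hκ one_pos, min_le_right _ _, fun v hv => ?_⟩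
  by_cases h0 : v = 0
  · simp [h0]
  have hn : ‖v‖ ≠ 0 := norm_ne_zero_iff.mpr h0
  have hw : ((‖v‖⁻¹ : ℝ) : ℂ) • v ∈ S := by
    refine ⟨?_, Submodule.smul_mem _ _ hv⟩
    simp [norm_smul, hn]
  have h1 := hle _ hw
  have h2 : f (((‖v‖⁻¹ : ℝ) : ℂ) • v) = (‖v‖ ^ 2)⁻¹ * f v := by
    simp only [f, map_smul, ← smul_sub, norm_smul, mul_pow, Finset.mul_sum]
    simp
  rw [h2] at h1
  have h3 : 0 < ‖v‖ ^ 2 := by positivity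
  calc min κ 1 * ‖v‖ ^ 2 ≤ κ * ‖v‖ ^ 2 := by gcongr; exact min_le_left _ _
    _ ≤ ((‖v‖ ^ 2)⁻¹ * f v) * ‖v‖ ^ 2 := by gcongr
    _ = f v := by field_simp

/-- The powers of the average of finitely many orthogonal projections converge to the orthogonal
projection onto the intersection. -/
theorem tendsto_average_starProjection_pow {r : ℕ} (hr : r ≠ 0) (K : Fin r → Submodule ℂ V)
    (T : V →ₗ[ℂ] V) (hT : ∀ v, T v = (r : ℂ)⁻¹ • ∑ i, (K i).starProjection v) (v : V) :
    Tendsto (fun n => (T ^ n) v) atTop (𝓝 ((⨅ i, K i).starProjection v)) := by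
  obtain ⟨κ, hκ, hκ1, hle⟩ := exists_sum_dist_sq_ge K
  set Q := (⨅ i, K i).starProjection
  have hr1 : (1 : ℝ) ≤ r := by exact_mod_cast Nat.one_le_iff_ne_zero.mpr hr
  have hrp : (0 : ℝ) < r := by linarith
  have hrC : (r : ℂ) ≠ 0 := by exact_mod_cast hr
  have hc0 : 0 ≤ 1 - κ / r := by
    have : κ / r ≤ 1 := by rw [div_le_one hrp]; linarith
    linarith
  have step : ∀ w ∈ (⨅ i, K i)ᗮ, ‖T w‖ ^ 2 ≤ (1 - κ / r) * ‖w‖ ^ 2 := by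
    intro w hw
    have h1 : ‖T w‖ ≤ (r : ℝ)⁻¹ * ∑ i, ‖(K i).starProjection w‖ := by
      rw [hT, norm_smul]
      simp only [norm_inv, Complex.norm_natCast]
      gcongr
      exact norm_sum_le _ _
    -- Cauchy–Schwarz, followed by Pythagoras for each projection, brings in the sum of squared
    -- distances.
    have h2 := sq_sum_le_card_mul_sum_sq (s := Finset.univ)
      (f := fun i => ‖(K i).starProjection w‖)
    simp only [Submodule.norm_sq_starProjection, Finset.sum_sub_distrib, Finset.sum_const,
      Finset.card_univ, Fintype.card_fin, nsmul_eq_mul] at h2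
    have h3 := hle w hw
    calc ‖T w‖ ^ 2 ≤ ((r : ℝ)⁻¹ * ∑ i, ‖(K i).starProjection w‖) ^ 2 := by gcongr
      _ = ((r : ℝ)⁻¹) ^ 2 * (∑ i, ‖(K i).starProjection w‖) ^ 2 := by ring
      _ ≤ ((r : ℝ)⁻¹) ^ 2 * (r * (r * ‖w‖ ^ 2 - κ * ‖w‖ ^ 2)) := by
          gcongr
          refine h2.trans ?_
          gcongr
      _ = (1 - κ / r) * ‖w‖ ^ 2 := by field_simp
  have hmem : ∀ w ∈ (⨅ i, K i)ᗮ, T w ∈ (⨅ i, K i)ᗮ := by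
    intro w hw
    rw [hT]
    exact Submodule.smul_mem _ _ (Submodule.sum_mem _ fun i _ =>
      Submodule.starProjection_mem_orthogonal_of_le (iInf_le K i) hw)
  have hfix : ∀ w ∈ (⨅ i, K i), T w = w := by
    intro w hw
    rw [hT, Finset.sum_congr rfl fun i _ => Submodule.starProjection_eq_self_iff.mpr
      ((Submodule.mem_iInf _).mp hw i)]
    simp [← Nat.cast_smul_eq_nsmul ℂ, smul_smul, hrC]
  have hQ : ∀ n, (T ^ n) (Q v) = Q v := by
    intro n
    induction n with
    | zero => rfl
    | succ n ih =>
      rw [pow_succ', Module.End.mul_apply, ih]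
      exact hfix _ (Submodule.starProjection_apply_mem _ v)
  set w := v - Q v
  have hw : w ∈ (⨅ i, K i)ᗮ := Submodule.sub_starProjection_mem_orthogonal v
  have hpow : ∀ n, (T ^ n) w ∈ (⨅ i, K i)ᗮ ∧ ‖(T ^ n) w‖ ^ 2 ≤ (1 - κ / r) ^ n * ‖w‖ ^ 2 := by
    intro n
    induction n with
    | zero => simpa using hw
    | succ n ih =>
      rw [pow_succ', Module.End.mul_apply]
      refine ⟨hmem _ ih.1, (step _ ih.1).trans ?_⟩
      rw [pow_succ' (1 - κ / r), mul_assoc]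
      gcongr
      exact ih.2
  have hlim : Tendsto (fun n => ‖(T ^ n) w‖ ^ 2) atTop (𝓝 0) := by
    refine squeeze_zero (fun n => sq_nonneg _) (fun n => (hpow n).2) ?_
    have : 1 - κ / r < 1 := by
      have := div_pos hκ hrp
      linarith
    simpa using (tendsto_pow_atTop_nhds_zero_of_lt_one hc0 this).mul_const (‖w‖ ^ 2)
  have hlim2 : Tendsto (fun n => (T ^ n) w) atTop (𝓝 0) := by
    rw [tendsto_zero_iff_norm_tendsto_zero]
    simpa using hlim.sqrt
  have : (fun n => (T ^ n) v) = fun n => (T ^ n) w + Q v := by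
    funext n
    simp only [w, map_sub, hQ, sub_add_cancel]
  rw [this]
  simpa using hlim2.add_const (Q v)

end Projections

/-! ### Mean-square contraction under independent random projections. -/

section RandomProjections

variable {Ω : Type*} [MeasurableSpace Ω] {P : Measure Ω} [IsProbabilityMeasure P]

theorem memLp_comp_of_finite {α F : Type*} [NormedAddCommGroup F] [Finite α] [MeasurableSpace α]
    [MeasurableSingletonClass α] (g : α → F) {φ : Ω → α} (hφ : Measurable φ) (p : ENNReal) :
    MemLp (fun ω => g (φ ω)) p P := by
  have := Fintype.ofFinite α
  refine MemLp.of_bound ?_ (∑ x, ‖g x‖) (ae_of_all _ fun ω => ?_)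
  · exact ((StronglyMeasurable.of_discrete (f := g)).comp_measurable hφ).aestronglyMeasurable
  · exact Finset.single_le_sum (f := fun x => ‖g x‖) (fun x _ => norm_nonneg _)
      (Finset.mem_univ (φ ω))

theorem sq_integral_norm_le {F : Type*} [NormedAddCommGroup F] {X : Ω → F} (hX : MemLp X 2 P) :
    (∫ ω, ‖X ω‖ ∂P) ^ 2 ≤ ∫ ω, ‖X ω‖ ^ 2 ∂P := by
  have h1 := variance_eq_sub (μ := P) hX.norm
  have h2 := variance_nonneg (fun ω => ‖X ω‖) P
  simp only [Pi.pow_apply] at h1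
  linarith

variable {r : ℕ} {j : ℕ → Ω → Fin r}

theorem measurable_history (hmeas : ∀ t, Measurable (j t)) (s : Finset ℕ) :
    Measurable fun ω (i : s) => j i ω :=
  measurable_pi_lambda _ fun i => hmeas i

variable {V : Type*} [NormedAddCommGroup V] [InnerProductSpace ℂ V] [FiniteDimensional ℂ V]

/-- One random orthogonal projection, independent of the past, contracts the mean square. -/
theorem integral_norm_sq_starProjection_le (K : Fin r → Submodule ℂ V)
    (hmeas : ∀ t, Measurable (j t)) (hindep : iIndepFun j P)
    {ε : ℝ} (hε : 0 < ε) (hprob : ∀ t i, ε < P.real {ω | j t ω = i})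
    {κ : ℝ} (hle : ∀ v ∈ (⨅ i, K i)ᗮ, κ * ‖v‖ ^ 2 ≤ ∑ i, ‖v - (K i).starProjection v‖ ^ 2)
    (t : ℕ) (g : (Finset.range (t + 1) → Fin r) → V)
    (hg : ∀ ω, g (fun i => j i ω) ∈ (⨅ i, K i)ᗮ) :
    ∫ ω, ‖(K (j (t + 1) ω)).starProjection (g fun i => j i ω)‖ ^ 2 ∂P
      ≤ (1 - ε * κ) * ∫ ω, ‖g fun i => j i ω‖ ^ 2 ∂P := by
  classical
  set H : Ω → (Finset.range (t + 1) → Fin r) := fun ω i => j i ω with hH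
  have hHm : Measurable H := measurable_history hmeas _
  have hind : IndepFun (j (t + 1)) H P := by
    have h := hindep.indepFun_finset {t + 1} (Finset.range (t + 1)) (by simp) hmeas
    have h2 : Measurable fun x : (({t + 1} : Finset ℕ) → Fin r) => x ⟨t + 1, by simp⟩ :=
      measurable_pi_apply _
    exact h.comp (φ := fun x => x ⟨t + 1, by simp⟩) (ψ := id) h2 measurable_id
  let D : Fin r → (Finset.range (t + 1) → Fin r) → ℝ :=
    fun i x => ‖g x - (K i).starProjection (g x)‖ ^ 2
  let ind : Fin r → Fin r → ℝ := fun i k => if k = i then 1 else 0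
  have hint : ∀ f : (Finset.range (t + 1) → Fin r) → ℝ, Integrable (fun ω => f (H ω)) P :=
    fun f => memLp_one_iff_integrable.mp (memLp_comp_of_finite f hHm 1)
  have hintj : ∀ i, Integrable (fun ω => ind i (j (t + 1) ω)) P :=
    fun i => memLp_one_iff_integrable.mp (memLp_comp_of_finite _ (hmeas _) 1)
  have hindD : ∀ i, IndepFun (fun ω => ind i (j (t + 1) ω)) (fun ω => D i (H ω)) P := fun i =>
    hind.comp (φ := ind i) (ψ := D i) .of_discrete .of_discrete
  have hintD : ∀ i, Integrable (fun ω => ind i (j (t + 1) ω) * D i (H ω)) P := fun i =>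
    (hindD i).integrable_mul (hintj i) (hint (D i))
  -- Pythagoras, with the random index expanded in indicators so that each summand is a product of
  -- independent factors.
  have hpt : ∀ ω, ‖(K (j (t + 1) ω)).starProjection (g (H ω))‖ ^ 2
      = ‖g (H ω)‖ ^ 2 - ∑ i, ind i (j (t + 1) ω) * D i (H ω) := by
    intro ω
    rw [Submodule.norm_sq_starProjection]
    simp [ind, D]
  have hprod : ∀ i, ∫ ω, ind i (j (t + 1) ω) * D i (H ω) ∂P
      = P.real {ω | j (t + 1) ω = i} * ∫ ω, D i (H ω) ∂P := by
    intro i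
    have h1 := (hindD i).integral_mul_eq_mul_integral (hintj i).aestronglyMeasurable
      (hint (D i)).aestronglyMeasurable
    have h2 : ∫ ω, ind i (j (t + 1) ω) ∂P = P.real {ω | j (t + 1) ω = i} := by
      have h3 : MeasurableSet {ω | j (t + 1) ω = i} := hmeas (t + 1) (measurableSet_singleton i)
      rw [← integral_indicator_one h3]
      refine integral_congr_ae (ae_of_all _ fun ω => ?_)
      simp [ind, Set.indicator]
    rw [← h2]
    exact h1
  change ∫ ω, ‖(K (j (t + 1) ω)).starProjection (g (H ω))‖ ^ 2 ∂P
      ≤ (1 - ε * κ) * ∫ ω, ‖g (H ω)‖ ^ 2 ∂P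
  simp only [hpt]
  rw [integral_sub (hint fun x => ‖g x‖ ^ 2) (integrable_finsetSum _ fun i _ => hintD i),
    integral_finsetSum _ fun i _ => hintD i]
  have hlow : ε * (κ * ∫ ω, ‖g (H ω)‖ ^ 2 ∂P)
      ≤ ∑ i, ∫ ω, ind i (j (t + 1) ω) * D i (H ω) ∂P := by
    calc ε * (κ * ∫ ω, ‖g (H ω)‖ ^ 2 ∂P)
        ≤ ε * ∑ i, ∫ ω, D i (H ω) ∂P := by
          gcongr
          rw [← integral_const_mul, ← integral_finsetSum _ fun i _ => hint (D i)]
          exact integral_mono ((hint fun x => ‖g x‖ ^ 2).const_mul κ)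
            (integrable_finsetSum _ fun i _ => hint (D i)) fun ω => hle _ (hg ω)
      _ ≤ _ := by
          rw [Finset.mul_sum]
          refine Finset.sum_le_sum fun i _ => ?_
          rw [hprod]
          have : 0 ≤ ∫ ω, D i (H ω) ∂P := integral_nonneg fun ω => sq_nonneg _
          gcongr
          exact (hprob _ _).le
  linarith

/-- Independent random orthogonal projections drive the component orthogonal to the intersection
to zero in mean square. -/
theorem tendsto_integral_norm_sq_of_random_starProjection (K : Fin r → Submodule ℂ V)
    (hmeas : ∀ t, Measurable (j t)) (hindep : iIndepFun j P)
    {ε : ℝ} (hε : 0 < ε) (hprob : ∀ t i, ε < P.real {ω | j t ω = i})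
    (v : ℕ → Ω → V) (g : ∀ t, (Finset.range (t + 1) → Fin r) → V)
    (hg : ∀ t ω, v t ω = g t fun i => j i ω) (h0 : ∀ ω, v 0 ω ∈ (⨅ i, K i)ᗮ)
    (hrec : ∀ t ω, v (t + 1) ω = (K (j (t + 1) ω)).starProjection (v t ω)) :
    Tendsto (fun t => ∫ ω, ‖v t ω‖ ^ 2 ∂P) atTop (𝓝 0) := by
  obtain ⟨κ, hκ, hκ1, hle⟩ := exists_sum_dist_sq_ge K
  have hmem : ∀ t ω, v t ω ∈ (⨅ i, K i)ᗮ := by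
    intro t ω
    induction t with
    | zero => exact h0 ω
    | succ t ih =>
      rw [hrec]
      exact Submodule.starProjection_mem_orthogonal_of_le (iInf_le K _) ih
  have hε1 : ε < 1 := by
    obtain ⟨ω⟩ : Nonempty Ω := P.nonempty_of_neZero
    exact (hprob 0 (j 0 ω)).trans_le measureReal_le_one
  have hc0 : 0 ≤ 1 - ε * κ := by nlinarith
  have hc1 : 1 - ε * κ < 1 := by nlinarith
  have hbound : ∀ t, ∫ ω, ‖v t ω‖ ^ 2 ∂P ≤ (1 - ε * κ) ^ t * ∫ ω, ‖v 0 ω‖ ^ 2 ∂P := by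
    intro t
    induction t with
    | zero => simp
    | succ t ih =>
      have h := integral_norm_sq_starProjection_le K hmeas hindep hε hprob hle t (g t)
        fun ω => by rw [← hg]; exact hmem t ω
      simp only [← hg, ← hrec] at h
      refine h.trans ?_
      rw [pow_succ', mul_assoc]
      gcongr
  refine squeeze_zero (fun t => integral_nonneg fun ω => sq_nonneg _) hbound ?_
  simpa using (tendsto_pow_atTop_nhds_zero_of_lt_one hc0 hc1).mul_const _

end RandomProjections

theorem Matrix.isUnit_of_rank_eq {d : ℕ} {ρ : Op d} (h : ρ.rank = d) : IsUnit ρ := by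
  rw [← Matrix.mulVec_surjective_iff_isUnit]
  have : LinearMap.range ρ.mulVecLin = ⊤ :=
    Submodule.eq_top_of_finrank_eq (by rw [Module.finrank_fin_fun]; exact h)
  exact LinearMap.range_eq_top.mp this

/-- Writing `ρ⁻¹ = s⋆ s`, the coordinates are the entries of `s X`, so that `‖e X‖² = Tr (X⋆ ρ⁻¹
X)`. The trace of the Schwarz inequality is then contractivity. -/
theorem exists_inverse_weighted_equiv {d : ℕ} {ρ : Op d} (hρ : ρ.PosSemidef) (hu : IsUnit ρ) :
    ∃ e : Op d ≃ₗ[ℂ] EuclideanSpace ℂ (Fin d × Fin d),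
      ∀ E : Op d →ₗ[ℂ] Op d, IsCPTP E → E ρ = ρ → ∀ X, ‖e (E X)‖ ≤ ‖e X‖ := by
  obtain ⟨u, rfl⟩ := hu
  set R : Op d := ↑u⁻¹
  have hR : R.PosSemidef := by
    have := hρ.inv
    simpa [R] using this
  obtain ⟨s, hs⟩ := CStarAlgebra.nonneg_iff_eq_star_mul_self.mp hR.nonneg
  have hleft : (u : Op d) * star s * s = 1 := by rw [mul_assoc, ← hs]; simp [R]
  have hright : s * ((u : Op d) * star s) = 1 := mul_eq_one_comm.mp hleft
  let m : Op d ≃ₗ[ℂ] Op d := LinearEquiv.ofLinearMap (LinearMap.mulLeft ℂ s)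
    (LinearMap.mulLeft ℂ ((u : Op d) * star s))

    (LinearMap.ext fun X => by
      change s * ((u : Op d) * star s * X) = X
      rw [← mul_assoc, hright, one_mul])
    (LinearMap.ext fun X => by
      change (u : Op d) * star s * (s * X) = X
      rw [← mul_assoc, hleft, one_mul])
  let c : Op d ≃ₗ[ℂ] EuclideanSpace ℂ (Fin d × Fin d) :=
    (LinearEquiv.curry ℂ ℂ (Fin d) (Fin d)).symm.trans (WithLp.linearEquiv 2 ℂ _).symm
  have hnorm : ∀ X, ‖(m.trans c) X‖ ^ 2 = ((star X * R * X).trace).re := by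
    intro X
    have h1 : star X * R * X = star (s * X) * (s * X) := by rw [hs, star_mul]; simp only [mul_assoc]
    have h2 : ∀ Y : Op d, ‖c Y‖ ^ 2 = ((star Y * Y).trace).re := by
      intro Y
      rw [EuclideanSpace.norm_sq_eq, Fintype.sum_prod_type_right]
      simp [Matrix.trace, Matrix.mul_apply, Matrix.star_apply, Complex.sq_norm, Complex.normSq_apply]
      rfl
    rw [h1, ← h2]
    rfl
  refine ⟨m.trans c, fun E hE hfix X => ?_⟩
  obtain ⟨⟨Φ, rfl⟩, htr⟩ := hE
  refine le_of_sq_le_sq ?_ (norm_nonneg _)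
  rw [hnorm, hnorm]
  have h := Φ.star_mul_inverse_mul_le hρ.nonneg (R := R) (by simp [R]) (by simp [R]) hfix X
  have h3 := (Matrix.le_iff.mp h).trace_nonneg
  rw [Matrix.trace_sub] at h3
  have h4 := htr (star X * R * X)
  have h5 : (Φ (star X * R * X)).trace = (star X * R * X).trace := h4
  rw [h5] at h3
  have h6 : (star (Φ X) * R * Φ X).trace.re ≤ (star X * R * X).trace.re := by
    simpa using (Complex.le_def.mp h3).1
  exact h6

/-! ### Closure of CPTP maps under products, averages and limits. -/

section CPTPClosure

theorem CStarAlgebra.isClosed_setOf_nonneg {B : Type*} [CStarAlgebra B] [PartialOrder B]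
    [StarOrderedRing B] : IsClosed {a : B | 0 ≤ a} := CStarAlgebra.isClosed_nonneg

theorem CStarAlgebra.complex_smul_nonneg {B : Type*} [CStarAlgebra B] [PartialOrder B]
    [StarOrderedRing B] {c : ℂ} {a : B} (hc : 0 ≤ c) (ha : 0 ≤ a) : 0 ≤ c • a :=
  smul_nonneg hc ha

variable {d : ℕ}

theorem isCPTP_iff {E : Op d →ₗ[ℂ] Op d} :
    IsCPTP E ↔ (∀ (k : ℕ) (M : CStarMatrix (Fin k) (Fin k) (Op d)), 0 ≤ M → 0 ≤ M.map E) ∧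
      ∀ X : Op d, (E X).trace = X.trace :=
  and_congr_left fun _ => ⟨by rintro ⟨Φ, rfl⟩; exact Φ.map_cstarMatrix_nonneg',
    fun h => ⟨⟨E, h⟩, rfl⟩⟩

theorem IsCPTP.one : IsCPTP (1 : Op d →ₗ[ℂ] Op d) :=
  isCPTP_iff.mpr ⟨fun _ _ hM => hM, fun _ => rfl⟩

theorem IsCPTP.mul {E F : Op d →ₗ[ℂ] Op d} (hE : IsCPTP E) (hF : IsCPTP F) : IsCPTP (E * F) := by
  rw [isCPTP_iff] at *
  exact ⟨fun k M hM => hE.1 k _ (hF.1 k M hM), fun X => (hE.2 _).trans (hF.2 X)⟩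

theorem IsCPTP.pow {E : Op d →ₗ[ℂ] Op d} (hE : IsCPTP E) (n : ℕ) : IsCPTP (E ^ n) := by
  induction n with
  | zero => exact .one
  | succ n ih => rw [pow_succ]; exact ih.mul hE

theorem IsCPTP.average {r : ℕ} (hr : r ≠ 0) {E : Fin r → Op d →ₗ[ℂ] Op d}
    (hE : ∀ i, IsCPTP (E i)) : IsCPTP ((r : ℂ)⁻¹ • ∑ i, E i) := by
  simp only [isCPTP_iff] at *
  refine ⟨fun k M hM => ?_, fun X => ?_⟩
  · have h : M.map ((r : ℂ)⁻¹ • ∑ i, E i : Op d →ₗ[ℂ] Op d) = (r : ℂ)⁻¹ • ∑ i, M.map (E i) := by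
      have hs : ∀ (s : Finset (Fin r)) a b, (∑ i ∈ s, M.map (E i)) a b = ∑ i ∈ s, E i (M a b) := by
        classical
        intro s a b
        induction s using Finset.induction_on with
        | empty => rfl
        | insert i s hi ih =>
          rw [Finset.sum_insert hi, Finset.sum_insert hi, CStarMatrix.add_apply, ih]
          rfl
      ext1 a b
      rw [CStarMatrix.smul_apply, hs]
      simp [CStarMatrix.map_apply]
    rw [h]
    refine CStarAlgebra.complex_smul_nonneg (by positivity)
      (Finset.sum_nonneg fun i _ => (hE i).1 k M hM)
  · have hrC : (r : ℂ) ≠ 0 := by exact_mod_cast hr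
    simp [Matrix.trace_sum, (hE _).2, hrC]

theorem IsCPTP.of_tendsto {E : ℕ → Op d →ₗ[ℂ] Op d} {F : Op d →ₗ[ℂ] Op d}
    (hE : ∀ n, IsCPTP (E n)) (h : ∀ X, Tendsto (fun n => E n X) atTop (𝓝 (F X))) : IsCPTP F := by
  simp only [isCPTP_iff] at *
  refine ⟨fun k M hM => ?_, fun X => ?_⟩
  · have hlim : Tendsto (fun n => M.map (E n)) atTop (𝓝 (M.map F)) := by
      -- Convergence of matrices over `Op d` is entrywise, and the positive cone is closed.
      have : Tendsto (fun n (a b : Fin k) => E n (M a b)) atTop (𝓝 fun a b => F (M a b)) :=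
        tendsto_pi_nhds.mpr fun a => tendsto_pi_nhds.mpr fun b => h (M a b)
      exact this
    exact CStarAlgebra.isClosed_setOf_nonneg.mem_of_tendsto hlim
      (Eventually.of_forall fun n => (hE n).1 k M hM)
  · have hc : Continuous (Matrix.trace : Op d → ℂ) := by fun_prop
    have h1 := (hc.tendsto _).comp (h X)
    refine tendsto_nhds_unique h1 ?_
    simp [Function.comp_def, (hE _).2]

end CPTPClosure

/-! ### CPTP projections as orthogonal projections. -/

section Projections

variable {d : ℕ}

theorem IsCPTPProjectionOnto.apply_eq_self {E : Op d →ₗ[ℂ] Op d} {A : Submodule ℂ (Op d)}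
    (hE : IsCPTPProjectionOnto E A) {X : Op d} (hX : X ∈ A) : E X = X := by
  rw [← hE.2.2] at hX
  obtain ⟨Y, rfl⟩ := hX
  exact hE.2.1 Y

/-- In coordinates where CPTP maps fixing a given full-rank state are contractive, a CPTP
projection onto `A ∋ ρ` is the orthogonal projection onto the image of `A`. -/
theorem IsCPTPProjectionOnto.map_eq_starProjection {V : Type*} [NormedAddCommGroup V]
    [InnerProductSpace ℂ V] [FiniteDimensional ℂ V] {ρ : Op d} {e : Op d ≃ₗ[ℂ] V}
    (he : ∀ E : Op d →ₗ[ℂ] Op d, IsCPTP E → E ρ = ρ → ∀ X, ‖e (E X)‖ ≤ ‖e X‖)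
    {E : Op d →ₗ[ℂ] Op d} {A : Submodule ℂ (Op d)} (hE : IsCPTPProjectionOnto E A) (hρ : ρ ∈ A)
    (X : Op d) : e (E X) = (A.map e.toLinearMap).starProjection (e X) := by
  let T : V →ₗ[ℂ] V := e.toLinearMap ∘ₗ E ∘ₗ e.symm.toLinearMap
  have hT : ∀ v, T v = e (E (e.symm v)) := fun _ => rfl
  have hrange : LinearMap.range T = A.map e.toLinearMap := by
    rw [LinearMap.range_comp, LinearMap.range_comp_of_range_eq_top _ e.symm.range, hE.2.2]
  have h := LinearMap.eq_starProjection_range_of_idempotent_of_contractive T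
    (fun v => by simp [hT, hE.2.1])
    (fun v => by simpa [hT] using he E hE.1 (hE.apply_eq_self hρ) (e.symm v)) (e X)
  rw [hT, e.symm_apply_apply] at h
  rw [h]
  simp only [hrange]

/-- Factoring through a finite type gives measurability and integrability, and independence from the
next index. The history includes `j 0`, although that map is never applied. -/
theorem exists_factorization_trajectory {Ω : Type*} {r : ℕ} (E : Fin r → Op d →ₗ[ℂ] Op d)
    (j : ℕ → Ω → Fin r) (τ : Op d) (t : ℕ) : ∃ g : (Finset.range (t + 1) → Fin r) → Op d,
      ∀ ω, trajectory E (fun s => j s ω) τ t = g fun i => j i ω := by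
  induction t with
  | zero => exact ⟨fun _ => τ, fun _ => rfl⟩
  | succ t ih =>
    obtain ⟨g, hg⟩ := ih
    refine ⟨fun x => E (x ⟨t + 1, by simp⟩) (g fun i => x ⟨i, by
      have := Finset.mem_range.mp i.2
      simp only [Finset.mem_range]
      omega⟩), fun ω => ?_⟩
    rw [trajectory, hg]

theorem exists_bound_trace_sq {V : Type*} [NormedAddCommGroup V] [NormedSpace ℂ V]
    [FiniteDimensional ℂ V] (e : Op d ≃ₗ[ℂ] V) : ∃ C : ℝ, 0 < C ∧
      (∀ X : Op d, ‖X‖ ≤ C * ‖e X‖) ∧ ∀ X : Op d, (X ^ 2).trace.re ≤ C * ‖e X‖ ^ 2 := by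
  set f := LinearMap.toContinuousLinearMap e.symm.toLinearMap
  set g := LinearMap.toContinuousLinearMap (Matrix.traceLinearMap (Fin d) ℂ ℂ)
  have hf : ∀ X : Op d, ‖X‖ ≤ ‖f‖ * ‖e X‖ := fun X => by
    simpa [f] using f.le_opNorm (e X)
  refine ⟨‖f‖ + ‖g‖ * ‖f‖ ^ 2 + 1, by positivity, fun X => (hf X).trans ?_, fun X => ?_⟩
  · gcongr
    have : 0 ≤ ‖g‖ * ‖f‖ ^ 2 := by positivity
    linarith
  · calc (X ^ 2).trace.re ≤ ‖g (X ^ 2)‖ := Complex.re_le_norm _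
      _ ≤ ‖g‖ * ‖X ^ 2‖ := g.le_opNorm _
      _ ≤ ‖g‖ * ‖X‖ ^ 2 := by
        gcongr
        rw [sq, sq]
        exact norm_mul_le _ _
      _ ≤ ‖g‖ * (‖f‖ * ‖e X‖) ^ 2 := by gcongr; exact hf X
      _ = ‖g‖ * ‖f‖ ^ 2 * ‖e X‖ ^ 2 := by ring
      _ ≤ _ := by
        gcongr
        have := norm_nonneg f
        linarith

/-- CPTP projections with a common full-rank fixed state have a CPTP projection onto the
intersection of their images. -/
theorem exists_isCPTPProjectionOnto_iInf {r : ℕ} (hr : r ≠ 0) {E : Fin r → Op d →ₗ[ℂ] Op d}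
    {A : Fin r → Submodule ℂ (Op d)} (hE : ∀ i, IsCPTPProjectionOnto (E i) (A i))
    {V : Type*} [NormedAddCommGroup V]
    [InnerProductSpace ℂ V] [FiniteDimensional ℂ V] {ρ : Op d} {e : Op d ≃ₗ[ℂ] V}
    (he : ∀ E : Op d →ₗ[ℂ] Op d, IsCPTP E → E ρ = ρ → ∀ X, ‖e (E X)‖ ≤ ‖e X‖)
    (hρ : ∀ i, ρ ∈ A i) : ∃ F, IsCPTPProjectionOnto F (⨅ i, A i) := by
  have : Nonempty (Fin r) := ⟨⟨0, Nat.pos_of_ne_zero hr⟩⟩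
  let K : Fin r → Submodule ℂ V := fun i => (A i).map e.toLinearMap
  have hK : (⨅ i, A i).map e.toLinearMap = ⨅ i, K i := Submodule.map_iInf _ e.injective
  let Q : V →ₗ[ℂ] V := ((⨅ i, K i).starProjection : V →L[ℂ] V)
  let T : Op d →ₗ[ℂ] Op d := (r : ℂ)⁻¹ • ∑ i, E i
  let T' : V →ₗ[ℂ] V := e.toLinearMap ∘ₗ T ∘ₗ e.symm.toLinearMap
  have hT' : ∀ v, T' v = (r : ℂ)⁻¹ • ∑ i, (K i).starProjection v := fun v => by
    simp only [T', T, K, LinearMap.comp_apply, LinearMap.smul_apply, LinearMap.sum_apply,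
      map_smul, map_sum, LinearEquiv.coe_coe, (hE _).map_eq_starProjection he (hρ _),
      e.apply_symm_apply]
  have hpow : ∀ n X, (T' ^ n) (e X) = e ((T ^ n) X) := by
    intro n X
    induction n with
    | zero => rfl
    | succ n ih =>
      rw [pow_succ', pow_succ', Module.End.mul_apply, Module.End.mul_apply, ih]
      simp [T']
  let F : Op d →ₗ[ℂ] Op d := e.symm.toLinearMap ∘ₗ Q ∘ₗ e.toLinearMap
  have hF : ∀ X, F X = e.symm ((⨅ i, K i).starProjection (e X)) := fun _ => rfl
  refine ⟨F, IsCPTP.of_tendsto (E := fun n => T ^ n)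
    (fun n => (IsCPTP.average hr fun i => (hE i).1).pow n) fun X => ?_, fun X => ?_, ?_⟩
  · have h := tendsto_average_starProjection_pow hr K T' hT' (e X)
    have hc : Continuous e.symm := LinearMap.continuous_of_finiteDimensional e.symm.toLinearMap
    have h2 := (hc.tendsto _).comp h
    rw [hF]
    simpa only [Function.comp_def, hpow, e.symm_apply_apply] using h2
  · rw [hF, hF, e.apply_symm_apply, Submodule.starProjection_eq_self_iff.mpr
      (Submodule.starProjection_apply_mem _ _)]
  · ext X
    constructor
    · rintro ⟨Y, rfl⟩
      have h : (⨅ i, K i).starProjection (e Y) ∈ (⨅ i, A i).map e.toLinearMap := by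
        rw [hK]; exact Submodule.starProjection_apply_mem _ _
      obtain ⟨Z, hZ, hZe⟩ := h
      rw [hF, ← hZe]
      simpa using hZ
    · intro hX
      refine ⟨X, ?_⟩
      have h : e X ∈ ⨅ i, K i := by rw [← hK]; exact ⟨X, hX, rfl⟩
      rw [hF, Submodule.starProjection_eq_self_iff.mpr h, e.symm_apply_apply]

end Projections

/-- Mean-square convergence in some linear coordinates gives convergence in probability. -/
theorem convergesInProbability_of_integral_norm_sq {d : ℕ} {Ω : Type*} [MeasurableSpace Ω]
    {P : Measure Ω} [IsProbabilityMeasure P] {V : Type*} [NormedAddCommGroup V]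
    [NormedSpace ℂ V] [FiniteDimensional ℂ V] (e : Op d ≃ₗ[ℂ] V) {X : ℕ → Ω → Op d} {Y : Op d}
    (hL2 : ∀ t, MemLp (fun ω => e (X t ω - Y)) 2 P)
    (h : Tendsto (fun t => ∫ ω, ‖e (X t ω - Y)‖ ^ 2 ∂P) atTop (𝓝 0)) :
    ConvergesInProbability P X Y := by
  obtain ⟨C, hC, -, hCsq⟩ := exists_bound_trace_sq e
  intro δ hδ ε hε
  obtain ⟨T, hT⟩ := eventually_atTop.mp (h.eventually_lt_const
    (show 0 < δ * (ε / C) by positivity))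
  refine ⟨T, fun t ht => ?_⟩
  -- Markov's inequality; the level `ε / C` absorbs the constant comparing `Tr (X²)` with the
  -- squared norm of the coordinates.
  have h1 := mul_meas_ge_le_integral_of_nonneg (μ := P) (f := fun ω => ‖e (X t ω - Y)‖ ^ 2)
    (ae_of_all _ fun ω => sq_nonneg _) (hL2 t).norm.integrable_sq (ε / C)
  have h2 : P.real {ω | ((X t ω - Y) ^ 2).trace.re > ε}
      ≤ P.real {ω | ε / C ≤ ‖e (X t ω - Y)‖ ^ 2} := by
    refine measureReal_mono fun ω hω => ?_
    rw [Set.mem_ofPred_eq, div_le_iff₀ hC, mul_comm]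
    exact (le_of_lt hω).trans (hCsq _)
  have h3 := hT t ht
  have h4 : 0 < ε / C := by positivity
  refine h2.trans_lt (lt_of_mul_lt_mul_left (h1.trans_lt ?_) h4.le)
  rwa [mul_comm]

/-- Mean-square convergence in some linear coordinates gives convergence in expectation. -/
theorem convergesInExpectation_of_integral_norm_sq {d : ℕ} {Ω : Type*} [MeasurableSpace Ω]
    {P : Measure Ω} [IsProbabilityMeasure P] {V : Type*} [NormedAddCommGroup V]
    [NormedSpace ℂ V] [FiniteDimensional ℂ V] (e : Op d ≃ₗ[ℂ] V) {X : ℕ → Ω → Op d} {Y : Op d}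
    (hX : ∀ t, Integrable (X t) P) (hL2 : ∀ t, MemLp (fun ω => e (X t ω - Y)) 2 P)
    (h : Tendsto (fun t => ∫ ω, ‖e (X t ω - Y)‖ ^ 2 ∂P) atTop (𝓝 0)) :
    ConvergesInExpectation P X Y := by
  obtain ⟨C, hC, hCnorm, -⟩ := exists_bound_trace_sq e
  refine ⟨hX, ?_⟩
  rw [tendsto_iff_norm_sub_tendsto_zero]
  have hlim : Tendsto (fun t => C * √(∫ ω, ‖e (X t ω - Y)‖ ^ 2 ∂P)) atTop (𝓝 0) := by
    simpa using h.sqrt.const_mul C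
  refine squeeze_zero (fun _ => norm_nonneg _) (fun t => ?_) hlim
  have h1 : ∫ ω, X t ω ∂P - Y = ∫ ω, (X t ω - Y) ∂P := by
    rw [integral_sub (hX t) (integrable_const Y)]
    simp
  rw [h1]
  calc ‖∫ ω, (X t ω - Y) ∂P‖ ≤ ∫ ω, ‖X t ω - Y‖ ∂P := norm_integral_le_integral_norm _
    _ ≤ ∫ ω, C * ‖e (X t ω - Y)‖ ∂P :=
      integral_mono ((hX t).sub (integrable_const Y)).norm
        (((hL2 t).integrable one_le_two).norm.const_mul C) fun ω => hCnorm _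
    _ = C * ∫ ω, ‖e (X t ω - Y)‖ ∂P := integral_const_mul _ _
    _ ≤ _ := by
      gcongr
      exact Real.le_sqrt_of_sq_le (sq_integral_norm_le (hL2 t))

theorem mainTheorem9 {d r : ℕ}
    (E : Fin r → Op d →ₗ[ℂ] Op d) (A : Fin r → Submodule ℂ (Op d))
    (hE : ∀ i, IsCPTPProjectionOnto (E i) (A i))
    (hfull : ∃ ρ : Op d, IsState ρ ∧ ρ.rank = d ∧ ρ ∈ ⨅ i, A i)
    {Ω : Type*} [MeasurableSpace Ω] (P : Measure Ω) [IsProbabilityMeasure P]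
    (j : ℕ → Ω → Fin r) (hmeas : ∀ t, Measurable (j t)) (hindep : iIndepFun j P)
    (ε : ℝ) (hε : 0 < ε) (hprob : ∀ t i, ε < P.real {ω | j t ω = i}) :
    (∃! F : Op d →ₗ[ℂ] Op d, IsCPTPProjectionOnto F (⨅ i, A i)) ∧
    ∀ F : Op d →ₗ[ℂ] Op d, IsCPTPProjectionOnto F (⨅ i, A i) →
      ∀ τ : Op d, IsState τ →
        ConvergesInProbability P (fun t ω => trajectory E (fun s => j s ω) τ t) (F τ) ∧
        ConvergesInExpectation P (fun t ω => trajectory E (fun s => j s ω) τ t) (F τ) := by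
  obtain ⟨ρ, hρ, hrank, hρA⟩ := hfull
  have hρi : ∀ i, ρ ∈ A i := (Submodule.mem_iInf _).mp hρA
  obtain ⟨e, he⟩ := exists_inverse_weighted_equiv hρ.1 (Matrix.isUnit_of_rank_eq hrank)
  have : Nonempty (Fin r) := (P.nonempty_of_neZero).map (j 0)
  have hr : r ≠ 0 := Fin.pos_iff_nonempty.mpr this |>.ne'
  constructor
  · obtain ⟨F, hF⟩ := exists_isCPTPProjectionOnto_iInf hr hE he hρi
    refine ⟨F, hF, fun G hG => LinearMap.ext fun X => e.injective ?_⟩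
    rw [hF.map_eq_starProjection he hρA, hG.map_eq_starProjection he hρA]
  intro F hF τ _
  let K : Fin r → Submodule ℂ (EuclideanSpace ℂ (Fin d × Fin d)) := fun i =>
    (A i).map e.toLinearMap
  have hK : (⨅ i, A i).map e.toLinearMap = ⨅ i, K i := Submodule.map_iInf _ e.injective
  choose g hg using exists_factorization_trajectory E j τ
  have hL2 : ∀ t, MemLp (fun ω => e (trajectory E (fun s => j s ω) τ t - F τ)) 2 P := by
    intro t
    simp only [hg]
    exact memLp_comp_of_finite (fun x => e (g t x - F τ)) (measurable_history hmeas _) 2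
  have hlim : Tendsto (fun t => ∫ ω, ‖e (trajectory E (fun s => j s ω) τ t - F τ)‖ ^ 2 ∂P)
      atTop (𝓝 0) := by
    refine tendsto_integral_norm_sq_of_random_starProjection K hmeas hindep hε hprob _
      (fun t x => e (g t x - F τ)) (fun t ω => by rw [hg]) (fun ω => ?_) fun t ω => ?_
    · rw [trajectory, map_sub, hF.map_eq_starProjection he hρA, ← hK]
      exact Submodule.sub_starProjection_mem_orthogonal _
    -- The limit lies in every `A i`, so the error evolves by the same projections as the state.
    · have hfix : E (j (t + 1) ω) (F τ) = F τ := by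
        refine (hE _).apply_eq_self ((Submodule.mem_iInf _).mp ?_ _)
        rw [← hF.2.2]
        exact LinearMap.mem_range_self F τ
      rw [trajectory, ← (hE _).map_eq_starProjection he (hρi _), map_sub (E _), hfix]
  refine ⟨convergesInProbability_of_integral_norm_sq e hL2 hlim,
    convergesInExpectation_of_integral_norm_sq e (fun t => ?_) hL2 hlim⟩
  simp only [hg]
  exact memLp_one_iff_integrable.mp (memLp_comp_of_finite (g t) (measurable_history hmeas _) 1)
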